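/- A virtual link diagram is a closed oriented 1-manifold generically immersed in $\mathbf R^2$, each of whose double points is labelled either as a real crossing (with over/under information) or as a virtual crossing; virtual links are the equivalence classes of such diagrams under planar isotopy and the generalized Reidemeister moves (the real and the virtual Reidemeister moves I, II, III, and the mixed move III with two virtual crossings and one real crossing). A virtual link is classical if it is represented by a diagram without virtual crossings. For non-zero integers $r_1,\dots,r_s$ let $K(r_1,\dots,r_s)$ be the virtual link represented by the closure of the virtual 2-braid $$\sigma^{r_1}\,\tau\,\sigma^{r_2}\,\tau\cdots\sigma^{r_s}\,\tau ,$$ with both strands oriented in parallel, where $\sigma$ is the standard real generator (one real crossing) and $\tau$ is one virtual crossing. Suppose that $s$ is odd and $r_1+\cdots+r_s\neq 0$. Then: (1) $K(r_1,\dots,r_s)$ is not a classical link. (2) For every even $s'$ and all non-zero integers $r'_1,\dots,r'_{s'}$, the virtual links $K(r_1,\dots,r_s)$ and $K(r'_1,\dots,r'_{s'})$ are distinct. -/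

import Mathlib

/-!
Oriented virtual link diagrams in the plane.

A diagram is put in general position with respect to the height function and cut by horizontal lines
into layers, each of which contains exactly one local minimum (`cup`), local maximum (`cap`), real
crossing or virtual crossing, all other strands being vertical.  A diagram is thus a word of layers,
read from bottom to top.  Planar isotopy of such diagrams is generated by the exchange of the heights
of two distant pieces, by straightening a zigzag, and by sliding a crossing over a maximum or a minimum.
-/

/-- The kind of a double point between two strands that both run vertically.
* `over`: a real crossing, the strand from bottom left to top right passes over the other one;
* `under`: a real crossing, the strand from bottom left to top right passes under the other one;
* `virt`: a virtual crossing. -/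
inductive CrossingKind
  | over
  | under
  | virt
  deriving DecidableEq

/-- Over and under interchanged. Rotating the picture of a crossing by a right angle has this effect
on its kind, since the two diagonals are interchanged. -/
def CrossingKind.flip : CrossingKind → CrossingKind
  | .over => .under
  | .under => .over
  | .virt => .virt

/-- The elementary pieces of a diagram. A strand is labelled at each height by `true` if it is oriented
upwards there and by `false` if it is oriented downwards; the left leg of the local minimum `cup d` has
label `d` (and its right leg the opposite one). -/
inductive Piece
  | cup (d : Bool)
  | cap
  | cross (k : CrossingKind)
  deriving DecidableEq

/-- The number of strands that enter the piece from below. -/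
def Piece.inputs : Piece → ℕ
  | .cup _ => 0
  | .cap => 2
  | .cross _ => 2

/-- The number of strands that leave the piece at the top. -/
def Piece.outputs : Piece → ℕ
  | .cup _ => 2
  | .cap => 0
  | .cross _ => 2

/-- A horizontal layer: a piece that has exactly `pos` vertical strands on its left. -/
structure Layer where
  pos : ℕ
  piece : Piece
  deriving DecidableEq

/-- The orientations of the strands above a layer, from left to right, in terms of those below it;
`none` if the layer does not fit on top of these strands. The two legs of a `cap` must have opposite
orientations. -/
def Layer.step (x : Layer) (l : List Bool) : Option (List Bool) :=
  match x.piece, l.drop x.pos with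
  | .cup d, t => if x.pos ≤ l.length then some (l.take x.pos ++ d :: (!d) :: t) else none
  | .cap, a :: b :: t => if b = !a then some (l.take x.pos ++ t) else none
  | .cross _, a :: b :: t => some (l.take x.pos ++ b :: a :: t)
  | _, _ => none

/-- The orientations of the strands above a word of layers. -/
def runLayers : List Layer → List Bool → Option (List Bool)
  | [], l => some l
  | x :: w, l => (x.step l).bind (runLayers w)

/-- An oriented virtual link diagram: a word of layers that fit together, without strands at the bottom
and at the top. -/
structure VirtualLinkDiagram where
  word : List Layer
  closed : runLayers word [] = some []

/-- The triples of kinds for which a strand (or the crossing of the other two) may be moved across the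
opposite crossing of a triangle. The three strands, numbered from left to right at the bottom, cross
in the kinds `a` (first and second), `b` (first and third) and `c` (second and third).
* all three crossings are real, and one strand is above the other two and one is below the other two
  (the excluded values are those where the strands lie cyclically over each other);
* at least two of the crossings are virtual. -/
inductive TriangleAdmissible : CrossingKind → CrossingKind → CrossingKind → Prop
  | real (a b c : CrossingKind) (ha : a ≠ .virt) (hb : b ≠ .virt) (hc : c ≠ .virt)
      (h : b = a ∨ b = c) : TriangleAdmissible a b c
  | virtFirst (c : CrossingKind) : TriangleAdmissible .virt .virt c
  | virtOuter (b : CrossingKind) : TriangleAdmissible .virt b .virt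
  | virtLast (a : CrossingKind) : TriangleAdmissible a .virt .virt

/-- The local moves on words of layers: planar isotopies and generalized Reidemeister moves. -/
inductive LocalMove : List Layer → List Layer → Prop
  -- planar isotopy: the heights of a piece `p` and of a piece `q` to its right are exchanged
  | exchange (p q : Piece) (i k : ℕ) :
      LocalMove [⟨i, p⟩, ⟨i + p.outputs + k, q⟩] [⟨i + p.inputs + k, q⟩, ⟨i, p⟩]
  -- planar isotopy: zigzags are straightened
  | zigzagLeft (i : ℕ) (d : Bool) : LocalMove [⟨i + 1, .cup d⟩, ⟨i, .cap⟩] []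
  | zigzagRight (i : ℕ) (d : Bool) : LocalMove [⟨i, .cup d⟩, ⟨i + 1, .cap⟩] []
  -- planar isotopy: a crossing slides over a maximum or a minimum
  | slideCap (i : ℕ) (k : CrossingKind) :
      LocalMove [⟨i, .cross k⟩, ⟨i + 1, .cap⟩] [⟨i + 1, .cross k.flip⟩, ⟨i, .cap⟩]
  | slideCup (i : ℕ) (d : Bool) (k : CrossingKind) :
      LocalMove [⟨i + 1, .cup d⟩, ⟨i, .cross k⟩] [⟨i, .cup d⟩, ⟨i + 1, .cross k.flip⟩]
  -- first Reidemeister move, real and virtual: a kink is removed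
  | kinkCap (i : ℕ) (k : CrossingKind) : LocalMove [⟨i, .cross k⟩, ⟨i, .cap⟩] [⟨i, .cap⟩]
  | kinkCup (i : ℕ) (d : Bool) (k : CrossingKind) :
      LocalMove [⟨i, .cup d⟩, ⟨i, .cross k⟩] [⟨i, .cup (!d)⟩]
  -- second Reidemeister move, real and virtual
  | bigon (i : ℕ) (k : CrossingKind) : LocalMove [⟨i, .cross k⟩, ⟨i, .cross k.flip⟩] []
  -- third Reidemeister move, real, virtual and mixed
  | triangle (i : ℕ) (a b c : CrossingKind) (h : TriangleAdmissible a b c) :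
      LocalMove [⟨i, .cross a⟩, ⟨i + 1, .cross b⟩, ⟨i, .cross c⟩]
        [⟨i + 1, .cross c⟩, ⟨i, .cross b⟩, ⟨i + 1, .cross a⟩]

namespace VirtualLinkDiagram

/-- One diagram arises from the other by one local move. -/
def Move (D E : VirtualLinkDiagram) : Prop :=
  ∃ u v x y : List Layer, LocalMove x y ∧ D.word = u ++ x ++ v ∧ E.word = u ++ y ++ v

/-- Equivalence of diagrams: finite sequences of moves and inverse moves. -/
instance setoid : Setoid VirtualLinkDiagram := Relation.EqvGen.setoid Move

/-- A classical link diagram: one without virtual crossings. -/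
def IsClassical (D : VirtualLinkDiagram) : Prop :=
  ∀ x ∈ D.word, x.piece ≠ .cross .virt

end VirtualLinkDiagram

/-- Virtual links: equivalence classes of virtual link diagrams. -/
def VirtualLink : Type := Quotient VirtualLinkDiagram.setoid

/-- The virtual link represented by a diagram. -/
def VirtualLinkDiagram.link (D : VirtualLinkDiagram) : VirtualLink := Quotient.mk _ D

/-- A virtual link is classical if some classical diagram represents it. -/
def VirtualLink.IsClassical (L : VirtualLink) : Prop :=
  ∃ D : VirtualLinkDiagram, D.IsClassical ∧ D.link = L

/-- `r` half twists of the first two strands, the `r`-th power of the braid generator. -/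
def halfTwists (r : ℤ) : List Layer :=
  List.replicate r.natAbs ⟨0, .cross (if 0 < r then .over else .under)⟩

/-- The virtual 2-braid `σ ^ r₁ τ σ ^ r₂ τ ⋯ σ ^ rₛ τ`, where `σ` is the real and `τ` the virtual
generator. -/
def twoBraid {s : ℕ} (r : Fin s → ℤ) : List Layer :=
  (List.ofFn r).flatMap fun n => halfTwists n ++ [⟨0, .cross .virt⟩]

/-- A word in the real and virtual crossings of the first two strands does not change orientations if
these strands are both oriented upwards. -/
theorem runLayers_crossings (w : List Layer) (hw : ∀ x ∈ w, ∃ k, x = ⟨0, .cross k⟩)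
    (v : List Layer) (t : List Bool) :
    runLayers (w ++ v) (true :: true :: t) = runLayers v (true :: true :: t) := by
  induction w with
  | nil => rfl
  | cons x w ih =>
    obtain ⟨k, rfl⟩ := hw x (by simp)
    have h := ih fun y hy => hw y (by simp [hy])
    simpa [runLayers, Layer.step] using h

theorem mem_twoBraid {s : ℕ} (r : Fin s → ℤ) (x : Layer) (hx : x ∈ twoBraid r) :
    ∃ k, x = ⟨0, .cross k⟩ := by
  simp only [twoBraid, List.mem_flatMap, List.mem_append, List.mem_singleton, halfTwists,
    List.mem_replicate] at hx
  obtain ⟨n, -, ⟨-, rfl⟩ | rfl⟩ := hx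
  exacts [⟨_, rfl⟩, ⟨_, rfl⟩]

/-- The diagram `K(r₁, …, rₛ)`: the closure of the virtual 2-braid `σ ^ r₁ τ ⋯ σ ^ rₛ τ`, with both
strands of the braid oriented in parallel. -/
def twoBraidDiagram {s : ℕ} (r : Fin s → ℤ) : VirtualLinkDiagram where
  word := [⟨0, .cup true⟩, ⟨1, .cup true⟩] ++ (twoBraid r ++ [⟨1, .cap⟩, ⟨0, .cap⟩])
  closed := by
    have h := runLayers_crossings (twoBraid r) (mem_twoBraid r) [⟨1, .cap⟩, ⟨0, .cap⟩] [false, false]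
    simp only [List.cons_append, List.nil_append, runLayers, Layer.step, List.drop, List.take,
      List.length, Bool.not_true] at h ⊢
    simpa using h

/-- The virtual link `K(r₁, …, rₛ)`. -/
def twoBraidLink {s : ℕ} (r : Fin s → ℤ) : VirtualLink := (twoBraidDiagram r).link

/-!
Colourings of virtual link diagrams.

The edges of a diagram are coloured by two colours such that both strands change their colour at
every real crossing. The weight of a colouring is the sum of the signs of the real crossings at which
the two incoming colours agree. Whether a diagram has a colouring of weight zero is an invariant of
the virtual link.
-/

/-! The set of weights of colourings is an invariant (`hasColouring_iff_of_link_eq`): the two sides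
of a local move have colourings with the same boundary colours and the same weights
(`sameColourings_of_localMove`). The weight 0 separates the links in question. A classical diagram
has a checkerboard colouring of its regions. Colouring each edge by the shade on its left makes the
incoming colours differ at every crossing, so weight 0 occurs. In a parallel 2-braid, equal colours
at the bottom stay equal and every real crossing contributes its sign, so the weight is the sum of
the exponents. Different colours contribute nothing: `σ` swaps and flips them, which preserves the
pattern, while `τ` exchanges them, so they close up exactly when the number of `τ` is even. Hence
weight 0 occurs for even `s'`, but not for odd `s` with nonzero sum. Complementing the colour of
downward strands makes the stored bit just below a real crossing the incoming colour of its strand,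
whatever the orientation. -/

namespace VirtualLinkDiagram

/-- A strand at a given height: its orientation, and its colour, where the colour is complemented
if the strand is oriented downwards. -/
abbrev Strand : Type := Bool × Bool

/-- The other leg of a local maximum or minimum. -/
def Strand.opp (a : Strand) : Strand := (!a.1, !a.2)

end VirtualLinkDiagram

open VirtualLinkDiagram

/-- The change of a strand at a crossing. -/
def CrossingKind.recolour : CrossingKind → Strand → Strand
  | .virt, a => a
  | _, a => (a.1, !a.2)

/-- The sign of a crossing whose strands are oriented in parallel. -/
def CrossingKind.sign : CrossingKind → ℤ
  | .over => 1
  | .under => -1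
  | .virt => 0

/-- The contribution of a crossing to the weight of a colouring. -/
def CrossingKind.weight (k : CrossingKind) (a b : Strand) : ℤ :=
  if a.2 = b.2 then (if a.1 = b.1 then k.sign else -k.sign) else 0

namespace VirtualLinkDiagram

/-- A piece with a given number of strands on its left has a colouring with the given coloured strands
below and above it, of the given weight. -/
def PieceColouring : ℕ → Piece → List Strand → List Strand → ℤ → Prop
  | 0, .cup d, t, t', n => n = 0 ∧ ∃ c : Bool, t' = (d, c) :: (!d, !c) :: t
  | 0, .cap, a :: b :: t, t', n => n = 0 ∧ b = a.opp ∧ t' = t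
  | 0, .cross k, a :: b :: t, t', n =>
      n = k.weight a b ∧ t' = k.recolour b :: k.recolour a :: t
  | i + 1, p, a :: t, t', n => ∃ s, t' = a :: s ∧ PieceColouring i p t s n
  | _, _, _, _, _ => False

/-- A word of layers has a colouring with the given coloured strands below and above it, of the given
weight. -/
def WordColouring : List Layer → List Strand → List Strand → ℤ → Prop
  | [], l, l', n => l' = l ∧ n = 0
  | x :: w, l, l', n => ∃ m a b, PieceColouring x.pos x.piece l m a ∧ WordColouring w m l' b ∧
      n = a + b

theorem wordColouring_append (u v : List Layer) (l l' : List Strand) (n : ℤ) :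
    WordColouring (u ++ v) l l' n ↔
      ∃ m a b, WordColouring u l m a ∧ WordColouring v m l' b ∧ n = a + b := by
  induction u generalizing l n with
  | nil => simp [WordColouring]
  | cons x u ih =>
    simp only [List.cons_append, WordColouring, ih]
    constructor
    · rintro ⟨m, a, b, h, ⟨m', a', b', h₁, h₂, rfl⟩, rfl⟩
      exact ⟨m', _, b', ⟨m, a, a', h, h₁, rfl⟩, h₂, by ring⟩
    · rintro ⟨m', _, b', ⟨m, a, a', h, h₁, rfl⟩, h₂, rfl⟩
      exact ⟨m, a, _, h, ⟨m', a', b', h₁, h₂, rfl⟩, by ring⟩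

/-! ### Colourings lie over the orientations of strands -/

theorem step_succ_cons (i : ℕ) (p : Piece) (a : Bool) (t : List Bool) :
    Layer.step ⟨i + 1, p⟩ (a :: t) = (Layer.step ⟨i, p⟩ t).map (a :: ·) := by
  simp only [Layer.step, List.drop_succ_cons, List.take_succ_cons, List.length_cons,
    Nat.add_le_add_iff_right]
  cases p <;> rcases t.drop i with _ | ⟨b, _ | ⟨c, s⟩⟩ <;> simp

theorem step_succ_nil (i : ℕ) (p : Piece) : Layer.step ⟨i + 1, p⟩ [] = none := by
  cases p <;> simp [Layer.step]

theorem runLayers_append (u v : List Layer) (l : List Bool) :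
    runLayers (u ++ v) l = (runLayers u l).bind (runLayers v) := by
  induction u generalizing l with
  | nil => rfl
  | cons x u ih =>
    simp only [List.cons_append, runLayers, Option.bind_assoc]
    congr 1
    funext m
    exact ih m

theorem PieceColouring.step_eq {i : ℕ} {p : Piece} {l l' : List Strand} {n : ℤ}
    (h : PieceColouring i p l l' n) :
    Layer.step ⟨i, p⟩ (l.map Prod.fst) = some (l'.map Prod.fst) := by
  induction i generalizing l l' with
  | zero =>
    cases p with
    | cup d =>
      obtain ⟨-, c, rfl⟩ := h
      simp [Layer.step]
    | cap =>
      rcases l with _ | ⟨a, _ | ⟨b, t⟩⟩ <;> simp only [PieceColouring] at h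
      obtain ⟨-, rfl, rfl⟩ := h
      simp [Layer.step, Strand.opp]
    | cross k =>
      rcases l with _ | ⟨a, _ | ⟨b, t⟩⟩ <;> simp only [PieceColouring] at h
      obtain ⟨-, rfl⟩ := h
      cases k <;> simp [Layer.step, CrossingKind.recolour]
  | succ i ih =>
    rcases l with _ | ⟨a, t⟩ <;> simp only [PieceColouring] at h
    obtain ⟨s, rfl, h⟩ := h
    simp [step_succ_cons, ih h]

/-- Lets a coloured lower part of a diagram supply the fitting conditions in `SameColourings`. -/
theorem WordColouring.runLayers_eq {w : List Layer} {l l' : List Strand} {n : ℤ}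
    (h : WordColouring w l l' n) :
    runLayers w (l.map Prod.fst) = some (l'.map Prod.fst) := by
  induction w generalizing l n with
  | nil =>
    obtain ⟨rfl, -⟩ := h
    rfl
  | cons x w ih =>
    obtain ⟨m, a, b, h, h', -⟩ := h
    simp [runLayers, h.step_eq, ih h']

/-! ### Moving words to the right -/

/-- A layer with `i` additional vertical strands on its left. -/
def shiftLayer (i : ℕ) (x : Layer) : Layer := ⟨i + x.pos, x.piece⟩

/-- The two words have the same colourings whenever both fit on the strands below them. -/
def SameColourings (x y : List Layer) : Prop :=
  ∀ l : List Strand, runLayers x (l.map Prod.fst) ≠ none → runLayers y (l.map Prod.fst) ≠ none →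
    ∀ l' n, WordColouring x l l' n ↔ WordColouring y l l' n

theorem runLayers_shift_succ_cons (i : ℕ) (w : List Layer) (a : Bool) (t : List Bool) :
    runLayers (w.map (shiftLayer (i + 1))) (a :: t) =
      (runLayers (w.map (shiftLayer i)) t).map (a :: ·) := by
  induction w generalizing t with
  | nil => rfl
  | cons x w ih =>
    simp only [List.map_cons, runLayers, shiftLayer, Nat.add_right_comm i 1, step_succ_cons]
    cases Layer.step ⟨i + x.pos, x.piece⟩ t with
    | none => rfl
    | some m => exact ih m

theorem wordColouring_shift_succ_cons (i : ℕ) (w : List Layer) (a : Strand) (t l' : List Strand)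
    (n : ℤ) :
    WordColouring (w.map (shiftLayer (i + 1))) (a :: t) l' n ↔
      ∃ s, l' = a :: s ∧ WordColouring (w.map (shiftLayer i)) t s n := by
  induction w generalizing t n with
  | nil => simp [WordColouring]
  | cons x w ih =>
    simp only [List.map_cons, WordColouring, shiftLayer, Nat.add_right_comm i 1, PieceColouring]
    constructor
    · rintro ⟨_, b, c, ⟨m, rfl, h⟩, h', rfl⟩
      obtain ⟨s, rfl, hs⟩ := (ih _ _).1 h'
      exact ⟨s, rfl, m, b, c, h, hs, rfl⟩
    · rintro ⟨s, rfl, m, b, c, h, h', rfl⟩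
      exact ⟨_, b, c, ⟨m, rfl, h⟩, (ih _ _).2 ⟨s, rfl, h'⟩, rfl⟩

theorem runLayers_shift_succ_nil (i : ℕ) (x : Layer) (w : List Layer) :
    runLayers ((x :: w).map (shiftLayer (i + 1))) [] = none := by
  simp [runLayers, shiftLayer, Nat.add_right_comm i 1, step_succ_nil]

/-- Strands on the left are inert, so every move need only be checked at position 0. The first word
is nonempty because the empty word, unlike a shifted layer, fits on any number of strands. -/
theorem SameColourings.shift {x : Layer} {w y : List Layer} (h : SameColourings (x :: w) y) (i : ℕ) :
    SameColourings ((x :: w).map (shiftLayer i)) (y.map (shiftLayer i)) := by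
  induction i with
  | zero =>
    have : shiftLayer 0 = id := by
      funext z
      simp [shiftLayer]
    simpa only [this, List.map_id] using h
  | succ i ih =>
    rintro (_ | ⟨a, t⟩) hx hy l' n
    · exact absurd (runLayers_shift_succ_nil i x w) hx
    · rw [wordColouring_shift_succ_cons, wordColouring_shift_succ_cons]
      rw [List.map_cons (f := Prod.fst), runLayers_shift_succ_cons] at hx hy
      have key := ih t (fun e => hx (by rw [e]; rfl)) (fun e => hy (by rw [e]; rfl))
      simp only [key]

/-! ### Invariance under the local moves -/

theorem sameColourings_exchange (p q : Piece) (k : ℕ) :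
    SameColourings [⟨0, p⟩, ⟨p.outputs + k, q⟩] [⟨p.inputs + k, q⟩, ⟨0, p⟩] := by
  intro l _ _ l' n
  cases p with
  | cup d =>
    simp only [WordColouring, Piece.outputs, Piece.inputs, Nat.add_comm 2 k, PieceColouring, Nat.zero_add]
    constructor
    · rintro ⟨_, _, _, ⟨rfl, c, rfl⟩, ⟨_, a, _, ⟨_, rfl, _, rfl, h⟩, ⟨rfl, rfl⟩, rfl⟩, rfl⟩
      exact ⟨_, a, 0, h, ⟨_, 0, 0, ⟨rfl, c, rfl⟩, ⟨rfl, rfl⟩, rfl⟩, by ring⟩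
    · rintro ⟨_, a, _, h, ⟨_, _, _, ⟨rfl, c, rfl⟩, ⟨rfl, rfl⟩, rfl⟩, rfl⟩
      exact ⟨_, _, _, ⟨rfl, c, rfl⟩, ⟨_, a, _, ⟨_, rfl, _, rfl, h⟩, ⟨rfl, rfl⟩, rfl⟩, by ring⟩
  | cap =>
    rcases l with _ | ⟨a, _ | ⟨b, t⟩⟩ <;>
      simp only [WordColouring, Piece.outputs, Piece.inputs, Nat.add_comm 2 k, PieceColouring, Nat.zero_add,
        false_and, and_false, exists_false]
    constructor
    · rintro ⟨_, _, _, ⟨rfl, rfl, rfl⟩, ⟨_, e, _, h, ⟨rfl, rfl⟩, rfl⟩, rfl⟩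
      exact ⟨_, e, 0, ⟨_, rfl, _, rfl, h⟩, ⟨_, 0, 0, ⟨rfl, rfl, rfl⟩, ⟨rfl, rfl⟩, rfl⟩, by ring⟩
    · rintro ⟨_, e, _, ⟨_, rfl, _, rfl, h⟩, ⟨_, _, _, ⟨rfl, rfl, rfl⟩, ⟨rfl, rfl⟩, rfl⟩, rfl⟩
      exact ⟨_, _, _, ⟨rfl, rfl, rfl⟩, ⟨_, e, _, h, ⟨rfl, rfl⟩, rfl⟩, by ring⟩
  | cross j =>
    rcases l with _ | ⟨a, _ | ⟨b, t⟩⟩ <;>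
      simp only [WordColouring, Piece.outputs, Piece.inputs, Nat.add_comm 2 k, PieceColouring,
        false_and, and_false, exists_false]
    constructor
    · rintro ⟨_, _, _, ⟨rfl, rfl⟩, ⟨_, e, _, ⟨_, rfl, _, rfl, h⟩, ⟨rfl, rfl⟩, rfl⟩, rfl⟩
      exact ⟨_, e, _, ⟨_, rfl, _, rfl, h⟩, ⟨_, _, 0, ⟨rfl, rfl⟩, ⟨rfl, rfl⟩, rfl⟩, by ring⟩
    · rintro ⟨_, e, _, ⟨_, rfl, _, rfl, h⟩, ⟨_, _, _, ⟨rfl, rfl⟩, ⟨rfl, rfl⟩, rfl⟩, rfl⟩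
      exact ⟨_, _, _, ⟨rfl, rfl⟩, ⟨_, e, _, ⟨_, rfl, _, rfl, h⟩, ⟨rfl, rfl⟩, rfl⟩, by ring⟩

theorem sameColourings_zigzagLeft (d : Bool) : SameColourings [⟨1, .cup d⟩, ⟨0, .cap⟩] [] := by
  rintro (_ | ⟨⟨o, c⟩, t⟩) h _ l' n
  · simp [runLayers, Layer.step] at h
  -- The cap fits only if the zigzag carries the orientation of the incoming strand.
  · have ho : d = !o := by
      by_contra hd
      simp [runLayers, Layer.step, hd] at h
    subst ho
    cases c <;> simp [WordColouring, PieceColouring, Strand.opp] <;> exact and_comm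

theorem sameColourings_zigzagRight (d : Bool) : SameColourings [⟨0, .cup d⟩, ⟨1, .cap⟩] [] := by
  rintro (_ | ⟨⟨o, c⟩, t⟩) h _ l' n
  · simp [runLayers, Layer.step] at h
  · have ho : d = o := by
      by_contra hd
      cases d <;> cases o <;> simp [runLayers, Layer.step] at h hd
    subst ho
    cases c <;> simp [WordColouring, PieceColouring, Strand.opp]

/-- The flip of the kind is offset by the reversal of one strand relative to the vertical, so the
sign of the crossing is unchanged. -/
theorem sameColourings_slideCap (k : CrossingKind) :
    SameColourings [⟨0, .cross k⟩, ⟨1, .cap⟩] [⟨1, .cross k.flip⟩, ⟨0, .cap⟩] := by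
  rintro l - - l' n
  rcases l with _ | ⟨⟨o, a⟩, _ | ⟨⟨p, b⟩, _ | ⟨⟨q, c⟩, t⟩⟩⟩ <;>
    simp [WordColouring, PieceColouring]
  cases k <;> cases o <;> cases a <;> cases q <;> cases c <;> cases p <;> cases b <;>
    simp [CrossingKind.recolour, CrossingKind.weight, CrossingKind.sign, CrossingKind.flip,
      Strand.opp]

theorem sameColourings_slideCup (d : Bool) (k : CrossingKind) :
    SameColourings [⟨1, .cup d⟩, ⟨0, .cross k⟩] [⟨0, .cup d⟩, ⟨1, .cross k.flip⟩] := by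
  rintro l - - l' n
  rcases l with _ | ⟨⟨o, a⟩, t⟩ <;> simp [WordColouring, PieceColouring]
  cases k <;> cases o <;> cases a <;> cases d <;>
    simp [CrossingKind.recolour, CrossingKind.weight, CrossingKind.sign, CrossingKind.flip, or_comm, and_comm]

/-- At a real kink the strand changes colour between its two visits to the crossing, so the incoming
colours differ and the weight is 0. -/
theorem sameColourings_kinkCap (k : CrossingKind) :
    SameColourings [⟨0, .cross k⟩, ⟨0, .cap⟩] [⟨0, .cap⟩] := by
  rintro l - - l' n
  rcases l with _ | ⟨⟨o, a⟩, _ | ⟨⟨p, b⟩, t⟩⟩ <;> simp [WordColouring, PieceColouring]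
  cases k <;> cases o <;> cases a <;> cases p <;> cases b <;>
    simp [CrossingKind.recolour, CrossingKind.weight, CrossingKind.sign, Strand.opp, and_comm]

theorem sameColourings_kinkCup (d : Bool) (k : CrossingKind) :
    SameColourings [⟨0, .cup d⟩, ⟨0, .cross k⟩] [⟨0, .cup (!d)⟩] := by
  rintro l - - l' n
  simp [WordColouring, PieceColouring]
  cases k <;> cases d <;>
    simp [CrossingKind.recolour, CrossingKind.weight, or_comm, and_or_left]

/-- Both colours flip twice or never; the incoming colours agree at both crossings or at neither,
and the signs are opposite. -/
theorem sameColourings_bigon (k : CrossingKind) :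
    SameColourings [⟨0, .cross k⟩, ⟨0, .cross k.flip⟩] [] := by
  rintro l h - l' n
  rcases l with _ | ⟨⟨o, a⟩, _ | ⟨⟨p, b⟩, t⟩⟩
  · simp [runLayers, Layer.step] at h
  · simp [runLayers, Layer.step] at h
  · simp [WordColouring, PieceColouring]
    cases k <;> cases o <;> cases a <;> cases p <;> cases b <;>
      simp [CrossingKind.recolour, CrossingKind.weight, CrossingKind.sign, CrossingKind.flip, and_comm]

theorem recolour_comm (k j : CrossingKind) (x : Strand) :
    k.recolour (j.recolour x) = j.recolour (k.recolour x) := by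
  cases k <;> cases j <;> rfl

theorem weight_recolour_recolour (k j : CrossingKind) (x y : Strand) :
    k.weight (j.recolour x) (j.recolour y) = k.weight x y := by
  obtain ⟨o, a⟩ := x
  obtain ⟨p, b⟩ := y
  cases j <;> cases a <;> cases b <;> rfl

/-- With three real crossings, each pair of strands meets after the same total parity of flips on
both sides, so agreement of colours is preserved. With two virtual crossings, the third sees the
same colours on both sides. -/
theorem TriangleAdmissible.weight_eq {a b c : CrossingKind} (h : TriangleAdmissible a b c)
    (x y z : Strand) :
    a.weight x y + (b.weight (a.recolour x) z + c.weight (a.recolour y) (b.recolour z)) =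
      c.weight y z + (b.weight x (c.recolour z) + a.weight (b.recolour x) (c.recolour y)) := by
  have virt_weight (u v : Strand) : CrossingKind.virt.weight u v = 0 := by
    simp [CrossingKind.weight, CrossingKind.sign]
  cases h with
  | real a b c ha hb hc h =>
    have e (k : CrossingKind) (hk : k ≠ .virt) : k.recolour = CrossingKind.over.recolour := by
      cases k
      exacts [rfl, rfl, absurd rfl hk]
    -- A flip may be moved from one strand to the other without affecting whether they agree.
    have e' (k : CrossingKind) (u v : Strand) : k.weight (CrossingKind.over.recolour u) v =
        k.weight u (CrossingKind.over.recolour v) := by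
      obtain ⟨o, a⟩ := u
      obtain ⟨p, b⟩ := v
      cases a <;> cases b <;> rfl
    rw [e a ha, e b hb, e c hc, weight_recolour_recolour, weight_recolour_recolour, e']
    ring
  | virtFirst c => simp [virt_weight, CrossingKind.recolour]
  | virtOuter b => simp [virt_weight, CrossingKind.recolour]
  | virtLast a => simp [virt_weight, CrossingKind.recolour]

theorem sameColourings_triangle {a b c : CrossingKind} (h : TriangleAdmissible a b c) :
    SameColourings [⟨0, .cross a⟩, ⟨1, .cross b⟩, ⟨0, .cross c⟩]
      [⟨1, .cross c⟩, ⟨0, .cross b⟩, ⟨1, .cross a⟩] := by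
  rintro l hl - l' n
  rcases l with _ | ⟨x, _ | ⟨y, _ | ⟨z, t⟩⟩⟩
  iterate 3 simp [runLayers, Layer.step] at hl
  have e := TriangleAdmissible.weight_eq h x y z
  simp only [WordColouring, PieceColouring]
  constructor
  · rintro ⟨_, _, _, ⟨rfl, rfl⟩, ⟨_, _, _, ⟨_, rfl, rfl, rfl⟩, ⟨_, _, _, ⟨rfl, rfl⟩, ⟨rfl, rfl⟩, rfl⟩,
      rfl⟩, rfl⟩
    refine ⟨_, _, _, ⟨_, rfl, rfl, rfl⟩, ⟨_, _, _, ⟨rfl, rfl⟩, ⟨_, _, _, ⟨_, rfl, rfl, rfl⟩,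
      ⟨?_, rfl⟩, rfl⟩, rfl⟩, by linarith⟩
    rw [recolour_comm c b z, recolour_comm c a y, recolour_comm b a x]
  · rintro ⟨_, _, _, ⟨_, rfl, rfl, rfl⟩, ⟨_, _, _, ⟨rfl, rfl⟩, ⟨_, _, _, ⟨_, rfl, rfl, rfl⟩,
      ⟨rfl, rfl⟩, rfl⟩, rfl⟩, rfl⟩
    refine ⟨_, _, _, ⟨rfl, rfl⟩, ⟨_, _, _, ⟨_, rfl, rfl, rfl⟩, ⟨_, _, _, ⟨rfl, rfl⟩, ⟨?_, rfl⟩, rfl⟩,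
      rfl⟩, by linarith⟩
    rw [recolour_comm c b z, recolour_comm c a y, recolour_comm b a x]

theorem sameColourings_of_localMove {x y : List Layer} (h : LocalMove x y) : SameColourings x y := by
  cases h with
  | exchange p q i k =>
    simpa [shiftLayer, Nat.add_assoc] using (sameColourings_exchange p q k).shift i
  | zigzagLeft i d => exact (sameColourings_zigzagLeft d).shift i
  | zigzagRight i d => exact (sameColourings_zigzagRight d).shift i
  | slideCap i k => exact (sameColourings_slideCap k).shift i
  | slideCup i d k => exact (sameColourings_slideCup d k).shift i
  | kinkCap i k => exact (sameColourings_kinkCap k).shift i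
  | kinkCup i d k => exact (sameColourings_kinkCup d k).shift i
  | bigon i k => exact (sameColourings_bigon k).shift i
  | triangle i a b c h => exact (sameColourings_triangle h).shift i

/-! ### Invariance for diagrams and links -/

/-- The diagram has a colouring of weight `n`. -/
def HasColouring (D : VirtualLinkDiagram) (n : ℤ) : Prop := WordColouring D.word [] [] n

theorem runLayers_ne_none_of_closed (D : VirtualLinkDiagram) {u x v : List Layer}
    (hD : D.word = u ++ x ++ v) {m : List Bool} (hu : runLayers u [] = some m) :
    runLayers x m ≠ none := by
  intro hx
  have h := D.closed
  simp [hD, runLayers_append, hu, hx] at h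

theorem Move.hasColouring_iff {D E : VirtualLinkDiagram} (h : Move D E) (n : ℤ) :
    D.HasColouring n ↔ E.HasColouring n := by
  obtain ⟨u, v, x, y, hxy, hD, hE⟩ := h
  have key (m : List Strand) (a : ℤ) (hu : WordColouring u [] m a) :=
    sameColourings_of_localMove hxy m (D.runLayers_ne_none_of_closed hD hu.runLayers_eq)
      (E.runLayers_ne_none_of_closed hE hu.runLayers_eq)
  simp only [HasColouring, hD, hE, List.append_assoc, wordColouring_append u, wordColouring_append x,
    wordColouring_append y]
  constructor
  · rintro ⟨m, a, b, hu, ⟨m', a', b', hx, hv, rfl⟩, rfl⟩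
    exact ⟨m, a, _, hu, ⟨m', a', b', (key m a hu m' a').1 hx, hv, rfl⟩, rfl⟩
  · rintro ⟨m, a, b, hu, ⟨m', a', b', hx, hv, rfl⟩, rfl⟩
    exact ⟨m, a, _, hu, ⟨m', a', b', (key m a hu m' a').2 hx, hv, rfl⟩, rfl⟩

/-- The weights of the colourings of a diagram are invariants of the virtual link. -/
theorem hasColouring_iff_of_link_eq {D E : VirtualLinkDiagram} (h : D.link = E.link) (n : ℤ) :
    D.HasColouring n ↔ E.HasColouring n := by
  have h' : Relation.EqvGen Move D E := Quotient.exact h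
  clear h
  induction h' with
  | rel _ _ h => exact h.hasColouring_iff n
  | refl _ => rfl
  | symm _ _ _ ih => exact ih.symm
  | trans _ _ _ _ _ ih₁ ih₂ => exact ih₁.trans ih₂

/-! ### Classical diagrams have weight 0 -/

/-- The checkerboard colouring of the strands at a given height. -/
def checkerboard : Bool → List Bool → List Strand
  | _, [] => []
  | c, o :: l => (o, c) :: checkerboard (!c) l

/-- Alternation of the stored bits survives inserting or deleting two neighbours, and a real
crossing swaps and flips two different bits, leaving the pattern as it was. -/
theorem pieceColouring_checkerboard (i : ℕ) (p : Piece) (hp : p ≠ .cross .virt) (c : Bool)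
    (l l' : List Bool) (h : Layer.step ⟨i, p⟩ l = some l') :
    PieceColouring i p (checkerboard c l) (checkerboard c l') 0 := by
  induction i generalizing c l l' with
  | zero =>
    cases p with
    | cup d =>
      obtain rfl : d :: (!d) :: l = l' := by simpa [Layer.step] using h
      simp [PieceColouring, checkerboard]
    | cap =>
      rcases l with _ | ⟨a, _ | ⟨b, t⟩⟩ <;> simp [Layer.step] at h
      obtain ⟨rfl, rfl⟩ := h
      simp [PieceColouring, checkerboard, Strand.opp]
    | cross k =>
      rcases l with _ | ⟨a, _ | ⟨b, t⟩⟩ <;> simp [Layer.step] at h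
      subst h
      cases k <;> simp [PieceColouring, checkerboard, CrossingKind.weight, CrossingKind.recolour] at hp ⊢
  | succ i ih =>
    rcases l with _ | ⟨a, t⟩
    · simp [step_succ_nil] at h
    · rw [step_succ_cons, Option.map_eq_some_iff] at h
      obtain ⟨s, h, rfl⟩ := h
      exact ⟨_, rfl, ih _ _ _ h⟩

theorem wordColouring_checkerboard (w : List Layer) (hw : ∀ x ∈ w, x.piece ≠ .cross .virt)
    (l l' : List Bool) (h : runLayers w l = some l') :
    WordColouring w (checkerboard true l) (checkerboard true l') 0 := by
  induction w generalizing l with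
  | nil =>
    obtain rfl : l = l' := by simpa [runLayers] using h
    exact ⟨rfl, rfl⟩
  | cons x w ih =>
    obtain ⟨m, hm, h⟩ := Option.bind_eq_some_iff.1 h
    exact ⟨_, 0, 0, pieceColouring_checkerboard _ _ (hw x (by simp)) _ _ _ hm,
      ih (fun y hy => hw y (by simp [hy])) m h, rfl⟩

theorem IsClassical.hasColouring_zero {D : VirtualLinkDiagram} (hD : D.IsClassical) :
    D.HasColouring 0 :=
  wordColouring_checkerboard D.word hD [] [] D.closed

/-! ### Closures of virtual 2-braids -/

theorem wordColouring_replicate_of_eq {k : CrossingKind} {j : ℕ} {c : Bool} {t l' : List Strand} {n : ℤ}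
    (h : WordColouring (List.replicate j ⟨0, .cross k⟩) ((true, c) :: (true, c) :: t) l' n) :
    n = j * k.sign ∧ ∃ c', l' = (true, c') :: (true, c') :: t := by
  induction j generalizing c n with
  | zero =>
    obtain ⟨rfl, rfl⟩ := h
    exact ⟨by simp, c, rfl⟩
  | succ j ih =>
    obtain ⟨_, _, b, ⟨rfl, rfl⟩, h, rfl⟩ := h
    have hk : ∃ d, k.recolour (true, c) = (true, d) := by cases k <;> exact ⟨_, rfl⟩
    obtain ⟨d, hd⟩ := hk
    rw [hd] at h
    obtain ⟨rfl, hl⟩ := ih h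
    exact ⟨by simp [CrossingKind.weight]; ring, hl⟩

theorem wordColouring_halfTwists_of_eq {r : ℤ} {c : Bool} {t l' : List Strand} {n : ℤ}
    (h : WordColouring (halfTwists r) ((true, c) :: (true, c) :: t) l' n) :
    n = r ∧ ∃ c', l' = (true, c') :: (true, c') :: t := by
  obtain ⟨rfl, hl⟩ := wordColouring_replicate_of_eq h
  refine ⟨?_, hl⟩
  split_ifs with hr <;> simp only [CrossingKind.sign] <;> omega

theorem wordColouring_halfTwists_of_ne (r : ℤ) (c : Bool) (t l' : List Strand) (n : ℤ) :
    WordColouring (halfTwists r) ((true, c) :: (true, !c) :: t) l' n ↔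
      l' = (true, c) :: (true, !c) :: t ∧ n = 0 := by
  unfold halfTwists
  induction r.natAbs generalizing n with
  | zero => rfl
  | succ j ih =>
    rw [List.replicate_succ, WordColouring]
    split_ifs at ih ⊢ <;>
      simp [PieceColouring, CrossingKind.weight, CrossingKind.recolour, ih]

theorem wordColouring_twists_of_eq {rs : List ℤ} {c : Bool} {t l' : List Strand} {n : ℤ}
    (h : WordColouring (rs.flatMap fun r => halfTwists r ++ [⟨0, .cross .virt⟩])
      ((true, c) :: (true, c) :: t) l' n) : n = rs.sum := by
  induction rs generalizing c n with
  | nil => exact h.2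
  | cons r rs ih =>
    rw [List.flatMap_cons, wordColouring_append] at h
    obtain ⟨m, a, b, h, h', rfl⟩ := h
    obtain ⟨_, _, _, ht, ⟨_, _, _, hv, ⟨rfl, rfl⟩, rfl⟩, rfl⟩ := (wordColouring_append _ _ _ _ _).1 h
    obtain ⟨rfl, c', rfl⟩ := wordColouring_halfTwists_of_eq ht
    obtain ⟨rfl, rfl⟩ := hv
    rw [ih h']
    simp [CrossingKind.weight, CrossingKind.sign]

theorem wordColouring_twists_of_ne (rs : List ℤ) (c : Bool) (t l' : List Strand) (n : ℤ) :
    WordColouring (rs.flatMap fun r => halfTwists r ++ [⟨0, .cross .virt⟩])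
      ((true, c) :: (true, !c) :: t) l' n ↔
      l' = (true, c ^^ decide (Odd rs.length)) :: (true, !(c ^^ decide (Odd rs.length))) :: t ∧
        n = 0 := by
  induction rs generalizing c n with
  | nil => simp [WordColouring]
  | cons r rs ih =>
    -- The virtual crossing exchanges the two different bits, so the remaining word starts from the
    -- complement.
    have ih' := ih (!c)
    rw [Bool.not_not] at ih'
    simp [wordColouring_append, wordColouring_halfTwists_of_ne, WordColouring,
      PieceColouring, CrossingKind.weight, CrossingKind.recolour, ih', Nat.odd_add_one,
      -Nat.not_odd_iff_even]

theorem PieceColouring.cap_weight {i : ℕ} {l l' : List Strand} {n : ℤ}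
    (h : PieceColouring i .cap l l' n) : n = 0 := by
  induction i generalizing l l' with
  | zero =>
    rcases l with _ | ⟨a, _ | ⟨b, t⟩⟩ <;> simp only [PieceColouring] at h
    exact h.1
  | succ i ih =>
    rcases l with _ | ⟨a, t⟩ <;> simp only [PieceColouring] at h
    obtain ⟨s, -, h⟩ := h
    exact ih h

theorem twoBraidDiagram_hasColouring_zero {s : ℕ} (r : Fin s → ℤ) (hs : Even s) :
    (twoBraidDiagram r).HasColouring 0 := by
  -- The listed strands are the downward legs of the two nested cups, whose upward legs have bits
  -- `true` and `false`.
  have h := (wordColouring_twists_of_ne (List.ofFn r) true [(false, true), (false, false)] _ 0).2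
    ⟨rfl, rfl⟩
  rw [List.length_ofFn, decide_eq_false (Nat.not_odd_iff_even.2 hs)] at h
  refine (wordColouring_append _ _ _ _ _).2 ⟨_, 0, 0,
    ⟨_, 0, 0, ⟨rfl, true, rfl⟩, ⟨_, 0, 0, ⟨_, rfl, rfl, false, rfl⟩, ⟨rfl, rfl⟩, rfl⟩, rfl⟩,
    (wordColouring_append _ _ _ _ _).2 ⟨_, 0, 0, h, ?_, rfl⟩, rfl⟩
  simp [WordColouring, PieceColouring, Strand.opp]

theorem twoBraidDiagram_not_hasColouring_zero {s : ℕ} (r : Fin s → ℤ) (hs : Odd s)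
    (hsum : ∑ i, r i ≠ 0) : ¬ (twoBraidDiagram r).HasColouring 0 := by
  intro h
  obtain ⟨_, _, _, ⟨_, _, _, ⟨rfl, c, rfl⟩, ⟨_, _, _, ⟨_, rfl, rfl, d, rfl⟩, ⟨rfl, rfl⟩, rfl⟩, rfl⟩,
    h, hn⟩ := (wordColouring_append _ _ _ _ _).1 h
  obtain ⟨m, a, b, hr, h', rfl⟩ := (wordColouring_append _ _ _ _ _).1 h
  -- The bits of the two cups determine the colouring: equal bits give the nonzero weight, different
  -- bits fail to close up.
  obtain rfl | rfl : d = c ∨ d = !c := by cases c <;> cases d <;> simp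
  · have ha : a = ∑ i, r i := by rw [wordColouring_twists_of_eq hr, List.sum_ofFn]
    have hb : b = 0 := by
      obtain ⟨m', e, _, h₁, ⟨_, e', _, h₂, ⟨-, rfl⟩, rfl⟩, rfl⟩ := h'
      rw [h₁.cap_weight, h₂.cap_weight]
      rfl
    rw [ha, hb] at hn
    exact hsum (by linarith)
  · obtain ⟨rfl, -⟩ := (wordColouring_twists_of_ne _ _ _ _ _).1 hr
    -- After an odd number of exchanges the inner braid strand carries `c`, as does the downward
    -- strand next to it, whereas the cap needs complementary bits.
    rw [List.length_ofFn, decide_eq_true hs] at h'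
    simp [WordColouring, PieceColouring, Strand.opp] at h'

end VirtualLinkDiagram
theorem mainTheorem5 {s : ℕ} (r : Fin s → ℤ) (hr : ∀ i, r i ≠ 0) (hs : Odd s)
    (hsum : ∑ i, r i ≠ 0) :
    ¬ (twoBraidLink r).IsClassical ∧
      ∀ (s' : ℕ) (r' : Fin s' → ℤ), (∀ i, r' i ≠ 0) → Even s' →
        twoBraidLink r ≠ twoBraidLink r' := by
  have h0 := twoBraidDiagram_not_hasColouring_zero r hs hsum
  refine ⟨?_, fun s' r' _ hs' h => h0 ?_⟩
  · rintro ⟨D, hD, h⟩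
    exact h0 ((hasColouring_iff_of_link_eq h 0).1 hD.hasColouring_zero)
  · exact (hasColouring_iff_of_link_eq h 0).2 (twoBraidDiagram_hasColouring_zero r' hs')
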